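/- **Theorem 2.** Let $\Sigma$ be a finite alphabet. Series-parallel words over $\Sigma$ are built from the empty word $\varepsilon$ and the letters by an associative sequential product $\cdot$ and an associative, commutative parallel product $\|$, with $\varepsilon$ neutral for both; $SP(\Sigma)$ is the set of these words (that is, terms modulo these laws), and $\Sigma^{\oplus}\subseteq SP(\Sigma)$ is the set of parallel words $a_1\|\cdots\|a_n$ ($n\ge 0$, $a_i\in\Sigma$). * A language $L\subseteq\Sigma^{\oplus}$ is *parallel regular* if it belongs to the least class of subsets of $SP(\Sigma)$ that contains $\emptyset$ and $\{a\}$ for each $a\in\Sigma$ and is closed under $L_1\cup L_2$, $L_1\cdot L_2$, $L_1\|L_2$ and $L^{\oplus}=\bigcup_{n\ge 0}L_n$, where $L_0=\{\varepsilon\}$ and $L_{n+1}=L_n\|L$. * A *linear (parallel regular) grammar* $G=(V,\Sigma,P,S)$ has a finite set $V$ of variables, a start symbol $S\in V$, and a finite set $P$ of productions, each of the form $A\to x\|B$, $A\to B\|x$ or $A\to x$ with $A,B\in V$, $x\in\Sigma^{\oplus}$; $L(G)$ is the set of all $w\in\Sigma^{\oplus}$ that are derivable from $S$, where a derivation step replaces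 $A\|\gamma$ by $\beta\|\gamma$ for a production $A\to\beta$. * A *branching automaton* $\mathbf A=(Q,T_{seq},T_{fork},T_{join},T_{par},S,E)$ over $\Sigma$ has a finite set $Q$ of states, sets $S,E\subseteq Q$ of start and end states, and finite sets of transitions $T_{seq}\subseteq Q\times\Sigma\times Q$, $T_{fork}\subseteq Q\times M_{ns}(Q)$, $T_{join}\subseteq M_{ns}(Q)\times Q$ and $T_{par}\subseteq T_{fork}\times\Sigma^{\oplus}\times T_{join}$, where $M_{ns}(Q)$ is the set of multisets over $Q$ of cardinality at least $2$. Its runs, written $p\xrightarrow{x}q$ with $p,q\in Q$ and $x\in SP(\Sigma)$, are generated by the following rules: $p\xrightarrow{\varepsilon}p$; $p\xrightarrow{a}q$ if $(p,a,q)\in T_{seq}$; $p\xrightarrow{x\cdot y}r$ if $p\xrightarrow{x}q$ and $q\xrightarrow{y}r$; $p\xrightarrow{x_1\|\cdots\|x_n}q$ if $(p,\{p_1,\dots,p_n\})\in T_{fork}$, $(\{q_1,\dots,q_n\},q)\in T_{join}$ and $p_i\xrightarrow{x_i}q_i$ for all $i$; $p\xrightarrow{w}q$ if $((p,M),w,(N,q))\in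 T_{par}$ for some $M,N$. The language $L(\mathbf A)$ is the set of all $x$ with $p\xrightarrow{x}q$ for some $p\in S$, $q\in E$. Then for every language $L\subseteq\Sigma^{\oplus}$ of parallel words the following are equivalent: 1. $L$ is parallel regular; 2. $L=L(G)$ for some linear grammar $G$; 3. $L$ is recognized by a branching automaton, i.e. $L=L(\mathbf A)$ for some $\mathbf A$; 4. $L=L(\mathbf A)\cap\Sigma^{\oplus}$ for some branching automaton $\mathbf A$. In particular, for a linear grammar $G$, the language $L(G)$ is parallel regular if and only if it is recognized by a branching automaton. -/

import Mathlib

universe u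

/-- Series-parallel terms over `α`: built from the empty word and letters by sequential
composition `x · y` and parallel composition `x ‖ y`. -/
inductive SPTerm (α : Type u) : Type u
  | empty : SPTerm α
  | letter (a : α) : SPTerm α
  | seq (x y : SPTerm α) : SPTerm α
  | par (x y : SPTerm α) : SPTerm α

/-- The congruence on terms generated by: `·` is associative, `‖` is associative and commutative,
and the empty word is neutral for both. -/
inductive SPTerm.Equiv {α : Type u} : SPTerm α → SPTerm α → Prop
  | refl (x) : Equiv x x
  | symm {x y} : Equiv x y → Equiv y x
  | trans {x y z} : Equiv x y → Equiv y z → Equiv x z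
  | seq_congr {x x' y y'} : Equiv x x' → Equiv y y' → Equiv (.seq x y) (.seq x' y')
  | par_congr {x x' y y'} : Equiv x x' → Equiv y y' → Equiv (.par x y) (.par x' y')
  | seq_assoc (x y z) : Equiv (.seq (.seq x y) z) (.seq x (.seq y z))
  | empty_seq (x) : Equiv (.seq .empty x) x
  | seq_empty (x) : Equiv (.seq x .empty) x
  | par_assoc (x y z) : Equiv (.par (.par x y) z) (.par x (.par y z))
  | par_comm (x y) : Equiv (.par x y) (.par y x)
  | empty_par (x) : Equiv (.par .empty x) x

instance SPTerm.setoid (α : Type u) : Setoid (SPTerm α) where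
  r := SPTerm.Equiv
  iseqv := ⟨.refl, .symm, .trans⟩

/-- Series-parallel words over `α` (including the empty word). -/
def SPWord (α : Type u) : Type u := Quotient (SPTerm.setoid α)

namespace SPWord

variable {α : Type u}

/-- The empty word. -/
def empty : SPWord α := Quotient.mk _ SPTerm.empty

/-- The one-letter word `a`. -/
def letter (a : α) : SPWord α := Quotient.mk _ (SPTerm.letter a)

/-- Sequential composition `x · y`. -/
def seq (x y : SPWord α) : SPWord α :=
  Quotient.map₂ SPTerm.seq (fun _ _ h _ _ h' => SPTerm.Equiv.seq_congr h h') x y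

/-- Parallel composition `x ‖ y`. -/
def par (x y : SPWord α) : SPWord α :=
  Quotient.map₂ SPTerm.par (fun _ _ h _ _ h' => SPTerm.Equiv.par_congr h h') x y

theorem par_comm (x y : SPWord α) : par x y = par y x := by
  induction x using Quotient.inductionOn
  induction y using Quotient.inductionOn
  exact Quotient.sound (SPTerm.Equiv.par_comm _ _)

theorem par_assoc (x y z : SPWord α) : par (par x y) z = par x (par y z) := by
  induction x using Quotient.inductionOn
  induction y using Quotient.inductionOn
  induction z using Quotient.inductionOn
  exact Quotient.sound (SPTerm.Equiv.par_assoc _ _ _)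

instance : LeftCommutative (fun (a : α) (x : SPWord α) => par (letter a) x) where
  left_comm a b x := by
    rw [← par_assoc, par_comm (letter a), par_assoc]

end SPWord

/-- Parallel words `a₁ ‖ ⋯ ‖ aₙ` (`n ≥ 0`) over `α`, i.e. the elements of `α^⊕`. As `‖` is
associative and commutative, such a word is the multiset of its letters. -/
abbrev ParWord (α : Type u) : Type u := Multiset α

/-- The parallel word `a₁ ‖ ⋯ ‖ aₙ` as a series-parallel word. -/
def ParWord.toSP {α : Type u} (w : ParWord α) : SPWord α :=
  Multiset.foldr (fun a x => SPWord.par (SPWord.letter a) x) SPWord.empty w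

section RegularLanguages

variable {α : Type u}

/-- `L₁ · L₂ = {x · y | x ∈ L₁, y ∈ L₂}`. -/
def seqLang (L₁ L₂ : Set (SPWord α)) : Set (SPWord α) := Set.image2 SPWord.seq L₁ L₂

/-- `L₁ ‖ L₂ = {x ‖ y | x ∈ L₁, y ∈ L₂}`. -/
def parLang (L₁ L₂ : Set (SPWord α)) : Set (SPWord α) := Set.image2 SPWord.par L₁ L₂

/-- `L_n = L ‖ ⋯ ‖ L` (`n` factors), with `L_0 = {ε}`. -/
def parPow (L : Set (SPWord α)) : ℕ → Set (SPWord α)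
  | 0 => {SPWord.empty}
  | n + 1 => parLang (parPow L n) L

/-- The parallel Kleene closure `L^⊕ = ⋃ n ≥ 0, L_n`. -/
def parStar (L : Set (SPWord α)) : Set (SPWord α) := ⋃ n, parPow L n

/-- The languages denoted by parallel regular expressions: the least class that contains `∅` and
all `{a}` and is closed under `∪`, `·`, `‖` and `⊕`. -/
inductive IsParallelRational : Set (SPWord α) → Prop
  | empty : IsParallelRational ∅
  | letter (a : α) : IsParallelRational {SPWord.letter a}
  | union {L₁ L₂} : IsParallelRational L₁ → IsParallelRational L₂ → IsParallelRational (L₁ ∪ L₂)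
  | seq {L₁ L₂} : IsParallelRational L₁ → IsParallelRational L₂ →
      IsParallelRational (seqLang L₁ L₂)
  | par {L₁ L₂} : IsParallelRational L₁ → IsParallelRational L₂ →
      IsParallelRational (parLang L₁ L₂)
  | parStar {L} : IsParallelRational L → IsParallelRational (parStar L)

/-- A parallel regular language: a language of parallel words denoted by a parallel regular
expression. -/
def IsParallelRegular (L : Set (ParWord α)) : Prop := IsParallelRational (ParWord.toSP '' L)

end RegularLanguages

/-- Context free parallel grammars `(V, T, P, S)` with terminal alphabet `T = α`: finitely many
variables and finitely many productions `A → β` with `β ∈ (V ∪ T)^⊕`. -/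
structure ParallelGrammar (α : Type u) where
  Var : Type
  finite_var : Finite Var
  prods : Set (Var × ParWord (Var ⊕ α))
  finite_prods : prods.Finite
  start : Var

namespace ParallelGrammar

variable {α : Type u}

/-- One derivation step: `A ‖ γ ⇒ β ‖ γ` for a production `A → β`. -/
def Step (G : ParallelGrammar α) (u v : ParWord (G.Var ⊕ α)) : Prop :=
  ∃ (A : G.Var) (β γ : ParWord (G.Var ⊕ α)),
    (A, β) ∈ G.prods ∧ u = {Sum.inl A} + γ ∧ v = β + γ

/-- `L(G)`: the words over the terminals that are derivable from the start symbol. -/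
def language (G : ParallelGrammar α) : Set (ParWord α) :=
  {w | Relation.ReflTransGen G.Step {Sum.inl G.start} (w.map Sum.inr)}

/-- A grammar is linear (parallel regular) if every production has the form `A → x ‖ B` (which is
the same as `A → B ‖ x`) or `A → x`, with `B` a variable and `x` a parallel word of terminals. -/
def IsLinear (G : ParallelGrammar α) : Prop :=
  ∀ (A : G.Var) (β : ParWord (G.Var ⊕ α)), (A, β) ∈ G.prods →
    (∃ (x : ParWord α) (B : G.Var), β = x.map Sum.inr + {Sum.inl B}) ∨
      ∃ x : ParWord α, β = x.map Sum.inr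

end ParallelGrammar

/-- Finite branching automata over `α`, with sequential transitions `(p, a, q)`, fork transitions
`(p, M)`, join transitions `(N, q)`, where `M` and `N` are multisets of at least two states, and
parallel transitions `((p, M), w, (N, q))` made of a fork, a parallel word and a join. -/
structure BranchingAutomaton (α : Type u) where
  State : Type
  finite_state : Finite State
  seqTrans : Set (State × α × State)
  forkTrans : Set (State × Multiset State)
  joinTrans : Set (Multiset State × State)
  parTrans : Set ((State × Multiset State) × ParWord α × (Multiset State × State))
  finite_seq : seqTrans.Finite
  finite_fork : forkTrans.Finite
  finite_join : joinTrans.Finite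
  finite_par : parTrans.Finite
  two_le_card_fork : ∀ t ∈ forkTrans, 2 ≤ Multiset.card t.2
  two_le_card_join : ∀ t ∈ joinTrans, 2 ≤ Multiset.card t.1
  par_subset : ∀ t ∈ parTrans, t.1 ∈ forkTrans ∧ t.2.2 ∈ joinTrans
  start : Set State
  final : Set State

namespace BranchingAutomaton

variable {α : Type u}

/-- `A.Run p x q`: there is a run of `A` from `p` to `q` labelled `x`. In the rule `fork`, the list
`l` holds the branches `(pᵢ, xᵢ, qᵢ)`: the automaton forks from `p` into the multiset of the `pᵢ`,
runs from `pᵢ` to `qᵢ` on `xᵢ` for every `i`, and joins the multiset of the `qᵢ` into `q`; the label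
is the parallel composition of the `xᵢ`. -/
inductive Run (A : BranchingAutomaton α) : A.State → SPWord α → A.State → Prop
  | empty (p : A.State) : Run A p SPWord.empty p
  | letter {p q : A.State} {a : α} : (p, a, q) ∈ A.seqTrans → Run A p (SPWord.letter a) q
  | seq {p q r : A.State} {x y : SPWord α} :
      Run A p x q → Run A q y r → Run A p (SPWord.seq x y) r
  | fork {p q : A.State} (l : List (A.State × SPWord α × A.State)) :
      (p, (l.map (fun t => t.1) : Multiset A.State)) ∈ A.forkTrans →
      ((l.map (fun t => t.2.2) : Multiset A.State), q) ∈ A.joinTrans →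
      (∀ t ∈ l, Run A t.1 t.2.1 t.2.2) →
      Run A p ((l.map (fun t => t.2.1)).foldr SPWord.par SPWord.empty) q
  | par {p q : A.State} {M N : Multiset A.State} {w : ParWord α} :
      ((p, M), w, (N, q)) ∈ A.parTrans → Run A p w.toSP q

/-- The set of series-parallel words labelling a run from a start state to a final state. -/
def language (A : BranchingAutomaton α) : Set (SPWord α) :=
  {x | ∃ p ∈ A.start, ∃ q ∈ A.final, A.Run p x q}

end BranchingAutomaton

/-!
Parallel words form the free commutative monoid, and all four conditions say that `L` is semilinear
in it. The words generated by the variables of a grammar, or labelling the runs between the pairs of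
states of an automaton, are the least solution of a finite system of equations with semilinear
right-hand sides. Such a solution is semilinear, because the unknowns can be eliminated one at a
time: by commutativity, `X = S(X)` has the least solution `C + closure (D(C))`, where `C` consists
of the words of `S` without `X`, and `D` of those with one occurrence of `X` deleted. Conversely, a
finite union of linear sets `v + closure F` is generated by an explicit linear grammar, and
recognized by an explicit automaton.
-/

open scoped Pointwise

section Semilinear

variable {M : Type*} [AddCommMonoid M]

theorem coe_closure_eq_iUnion_nsmul (s : Set M) :
    (AddSubmonoid.closure s : Set M) = ⋃ n : ℕ, n • s := by
  refine subset_antisymm (fun x hx => ?_) (Set.iUnion_subset fun n => ?_)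
  · induction hx using AddSubmonoid.closure_induction_right with
    | zero => exact Set.mem_iUnion_of_mem 0 (Set.mem_zero.2 rfl)
    | add_right x _ y hy ih =>
      obtain ⟨n, hn⟩ := Set.mem_iUnion.1 ih
      exact Set.mem_iUnion_of_mem (n + 1) (succ_nsmul s n ▸ Set.add_mem_add hn hy)
  · exact AddSubmonoid.nsmul_subset AddSubmonoid.subset_closure

@[elab_as_elim]
theorem isSemilinearSet_induction {p : (s : Set M) → IsSemilinearSet s → Prop}
    (empty : p ∅ .empty) (singleton : ∀ a, p {a} (.singleton a))
    (union : ∀ s t hs ht, p s hs → p t ht → p (s ∪ t) (hs.union ht))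
    (add : ∀ s t hs ht, p s hs → p t ht → p (s + t) (hs.add ht))
    (closure : ∀ s hs, p s hs → p (AddSubmonoid.closure s : Set M) hs.closure)
    {s : Set M} (hs : IsSemilinearSet s) : p s hs := by
  have of_finite (t : Set M) (ht : t.Finite) : p t (.of_finite ht) := by
    induction t, ht using Set.Finite.induction_on with
    | empty => exact empty
    | insert _ ht ih => exact union _ _ _ (.of_finite ht) (singleton _) ih
  obtain ⟨S, hS, hlin, rfl⟩ := id hs
  induction S, hS using Set.Finite.induction_on with
  | empty => simpa using empty
  | @insert s S _ hS ih =>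
    have hlin' : ∀ t ∈ S, IsLinearSet t := fun t ht => hlin t (Set.mem_insert_of_mem _ ht)
    obtain ⟨a, t, ht, rfl⟩ := hlin s (Set.mem_insert _ _)
    simp only [Set.sUnion_insert, ← Set.singleton_vadd]
    exact union _ _ _ ⟨S, hS, hlin', rfl⟩
      (add _ _ _ _ (singleton a) (closure _ _ (of_finite t ht))) (ih hlin' _)

theorem exists_eq_iUnion_vadd_closure {s : Set M} (hs : IsSemilinearSet s) :
    ∃ (n : ℕ) (v : Fin n → M) (F : Fin n → Finset M),
      s = ⋃ i, v i +ᵥ (AddSubmonoid.closure (F i : Set M) : Set M) := by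
  obtain ⟨S, hS, hlin, rfl⟩ := hs
  choose! v F hvF using fun t ht => isLinearSet_iff.1 (hlin t ht)
  have := hS.to_subtype
  obtain ⟨n, ⟨e⟩⟩ := Finite.exists_equiv_fin S
  refine ⟨n, fun i => v (e.symm i), fun i => F (e.symm i), ?_⟩
  rw [Set.sUnion_eq_iUnion, ← e.symm.surjective.iUnion_comp]
  exact Set.iUnion_congr fun i => hvF _ (e.symm i).2

end Semilinear

section Substitution

variable {γ δ M : Type*} [AddCommMonoid M]

/-- The elements obtained from multisets in `S` by replacing every letter `c` by an element of
`σ c` and adding up. For `M = Multiset δ` this is the substitution of languages for letters. -/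
def substitute (σ : γ → Set M) (S : Set (Multiset γ)) : Set M := ⋃ m ∈ S, (m.map σ).sum

variable {σ τ : γ → Set M} {S T : Set (Multiset γ)} {x : M}

theorem mem_substitute : x ∈ substitute σ S ↔ ∃ m ∈ S, x ∈ (m.map σ).sum := by
  simp [substitute]

theorem sum_map_subset_substitute {m : Multiset γ} (hm : m ∈ S) :
    (m.map σ).sum ⊆ substitute σ S :=
  Set.subset_biUnion_of_mem (u := fun m => (m.map σ).sum) hm

theorem substitute_mono (hστ : ∀ c, σ c ⊆ τ c) (hST : S ⊆ T) :
    substitute σ S ⊆ substitute τ T :=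
  Set.biUnion_mono hST fun _ _ => Set.multiset_sum_subset_multiset_sum _ _ _ fun c _ => hστ c

@[simp] theorem substitute_empty (σ : γ → Set M) : substitute σ ∅ = ∅ := by
  simp [substitute]

@[simp] theorem substitute_singleton (σ : γ → Set M) (m : Multiset γ) :
    substitute σ {m} = (m.map σ).sum := by
  simp [substitute]

theorem substitute_union (σ : γ → Set M) (S T : Set (Multiset γ)) :
    substitute σ (S ∪ T) = substitute σ S ∪ substitute σ T :=
  Set.biUnion_union S T _

theorem substitute_add (σ : γ → Set M) (S T : Set (Multiset γ)) :
    substitute σ (S + T) = substitute σ S + substitute σ T := by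
  simp only [substitute, ← Set.image2_add, Set.biUnion_image2, Multiset.map_add, Multiset.sum_add,
    Set.image2_iUnion_left, Set.image2_iUnion_right]
  exact Set.iUnion₂_comm _

theorem substitute_closure (σ : γ → Set M) (S : Set (Multiset γ)) :
    substitute σ (AddSubmonoid.closure S) = AddSubmonoid.closure (substitute σ S) := by
  refine subset_antisymm (Set.iUnion₂_subset fun m hm => ?_) fun x hx => ?_
  · induction hm using AddSubmonoid.closure_induction with
    | mem m hm => exact (sum_map_subset_substitute hm).trans AddSubmonoid.subset_closure
    | zero => simp
    | add m n _ _ ihm ihn =>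
      rw [Multiset.map_add, Multiset.sum_add]
      exact (Set.add_subset_add ihm ihn).trans_eq (coe_add_coe _)
  · induction hx using AddSubmonoid.closure_induction with
    | mem x hx => exact substitute_mono (fun _ => subset_rfl) AddSubmonoid.subset_closure hx
    | zero => exact mem_substitute.2 ⟨0, zero_mem _, by simp⟩
    | add x y _ _ ihx ihy =>
      rw [← coe_add_coe (AddSubmonoid.closure S), substitute_add]
      exact Set.add_mem_add ihx ihy

theorem substitute_image_map (σ : γ → Set M) (f : δ → γ) (S : Set (Multiset δ)) :
    substitute σ (Multiset.map f '' S) = substitute (σ ∘ f) S := by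
  simp [substitute]

theorem substitute_sum_map (τ : δ → Set M) (σ : γ → Set (Multiset δ)) (m : Multiset γ) :
    substitute τ (m.map σ).sum = (m.map fun c => substitute τ (σ c)).sum := by
  induction m using Multiset.induction_on with
  | empty => simp [← Set.singleton_zero]
  | cons c m ih => simp only [Multiset.map_cons, Multiset.sum_cons, substitute_add, ih]

theorem substitute_substitute (τ : δ → Set M) (σ : γ → Set (Multiset δ)) (S : Set (Multiset γ)) :
    substitute τ (substitute σ S) = substitute (fun c => substitute τ (σ c)) S := by
  simp only [substitute, Set.biUnion_iUnion]
  exact Set.iUnion₂_congr fun m _ => substitute_sum_map τ σ m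

theorem isSemilinearSet_substitute (hσ : ∀ c, IsSemilinearSet (σ c)) (hS : IsSemilinearSet S) :
    IsSemilinearSet (substitute σ S) := by
  induction hS using isSemilinearSet_induction with
  | empty => simp
  | singleton m =>
    rw [substitute_singleton]
    induction m using Multiset.induction_on with
    | empty => simp [← Set.singleton_zero]
    | cons c m ih => rw [Multiset.map_cons, Multiset.sum_cons]; exact (hσ c).add ih
  | union S T _ _ hS hT => rw [substitute_union]; exact hS.union hT
  | add S T _ _ hS hT => rw [substitute_add]; exact hS.add hT
  | closure S _ hS => rw [substitute_closure]; exact hS.closure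

theorem isSemilinearSet_image_map (f : γ → δ) (hS : IsSemilinearSet S) :
    IsSemilinearSet (Multiset.map f '' S) :=
  hS.image (Multiset.mapAddMonoidHom f)

theorem substitute_subset_add {K : AddSubmonoid M} (h : ∀ c, τ c ⊆ σ c + K) :
    substitute τ S ⊆ substitute σ S + K := by
  have sum_map_subset (m : Multiset γ) : (m.map τ).sum ⊆ (m.map σ).sum + K := by
    induction m using Multiset.induction_on with
    | empty => simp
    | cons c m ih =>
      rw [Multiset.map_cons, Multiset.map_cons, Multiset.sum_cons, Multiset.sum_cons]
      calc τ c + (m.map τ).sum ⊆ (σ c + K) + ((m.map σ).sum + K) := Set.add_subset_add (h c) ih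
        _ = σ c + (m.map σ).sum + K := by rw [add_add_add_comm, coe_add_coe]
  exact Set.iUnion₂_subset fun m hm =>
    (sum_map_subset m).trans (Set.add_subset_add_right (sum_map_subset_substitute hm))

end Substitution

section Equation

variable {α : Type*}

/-- The substitution of `T` for the unknown `none`; the letters `some a` are kept. -/
def assignNone (T : Set (Multiset α)) (c : Option α) : Set (Multiset α) :=
  c.elim T fun a => {{a}}

/-- The words of `S` in which the unknown `none` does not occur. -/
def constants (S : Set (Multiset (Option α))) : Set (Multiset α) := {m | m.map some ∈ S}

/-- The words of `S` with one occurrence of the unknown `none` deleted. -/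
def derivative (S : Set (Multiset (Option α))) : Set (Multiset (Option α)) := {m | none ::ₘ m ∈ S}

/-- The words that the equation `X = S(X)` allows one to add to a solution: all occurrences of the
unknown but one are replaced by constants. -/
def increments (S : Set (Multiset (Option α))) : Set (Multiset α) :=
  substitute (assignNone (constants S)) (derivative S)

/-- The least solution of the equation `X = S(X)`, see `isLeast_solve`. -/
def solve (S : Set (Multiset (Option α))) : Set (Multiset α) :=
  constants S + AddSubmonoid.closure (increments S)

variable {S : Set (Multiset (Option α))}

theorem sum_map_singleton_singleton (m : Multiset α) :
    (m.map fun a => ({{a}} : Set (Multiset α))).sum = {m} := by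
  have h := Set.multiset_sum_singleton (m.map fun a => ({a} : Multiset α))
  rwa [Multiset.map_map, Multiset.sum_map_singleton] at h

theorem exists_map_some_eq {m : Multiset (Option α)} (h : none ∉ m) :
    ∃ k : Multiset α, k.map some = m := by
  have : CanLift (Option α) α some (· ≠ none) := ⟨fun _ => Option.ne_none_iff_exists.1⟩
  lift m to Multiset α using fun c hc => ne_of_mem_of_not_mem hc h
  exact ⟨m, rfl⟩

theorem substitute_assignNone (T : Set (Multiset α)) (S : Set (Multiset (Option α))) :
    substitute (assignNone T) S = constants S ∪ (T + substitute (assignNone T) (derivative S)) := by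
  have sum_map_some (m : Multiset α) : ((m.map some).map (assignNone T)).sum = {m} := by
    rw [Multiset.map_map]
    exact sum_map_singleton_singleton m
  have sum_map_none_cons (m : Multiset (Option α)) :
      ((none ::ₘ m).map (assignNone T)).sum = T + (m.map (assignNone T)).sum := by
    simp [assignNone]
  ext x
  simp only [mem_substitute, Set.mem_union, Set.mem_add]
  constructor
  · rintro ⟨m, hm, hx⟩
    by_cases h : none ∈ m
    · obtain ⟨m, rfl⟩ := Multiset.exists_cons_of_mem h
      rw [sum_map_none_cons] at hx
      obtain ⟨y, hy, z, hz, rfl⟩ := hx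
      exact .inr ⟨y, hy, z, ⟨m, hm, hz⟩, rfl⟩
    · obtain ⟨m, rfl⟩ := exists_map_some_eq h
      rw [sum_map_some, Set.mem_singleton_iff] at hx
      exact .inl (hx ▸ hm)
  · rintro (hx | ⟨y, hy, z, ⟨m, hm, hz⟩, rfl⟩)
    · exact ⟨x.map some, hx, by rw [sum_map_some]; rfl⟩
    · exact ⟨none ::ₘ m, hm, by rw [sum_map_none_cons]; exact Set.add_mem_add hy hz⟩

theorem assignNone_mono {T T' : Set (Multiset α)} (h : T ⊆ T') (c : Option α) :
    assignNone T c ⊆ assignNone T' c := by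
  cases c with
  | none => exact h
  | some a => exact subset_rfl

theorem isLeast_solve (S : Set (Multiset (Option α))) :
    IsLeast {T | substitute (assignNone T) S ⊆ T} (solve S) := by
  set K := AddSubmonoid.closure (increments S)
  constructor
  · have increments_add_subset : increments S + K ⊆ (K : Set (Multiset α)) :=
      (Set.add_subset_add_right AddSubmonoid.subset_closure).trans_eq (coe_add_coe K)
    have substitute_subset :
        substitute (assignNone (solve S)) (derivative S) ⊆ increments S + K :=
      substitute_subset_add fun c => by
        cases c with
        | none => exact subset_rfl
        | some a => exact Set.subset_add_left _ (zero_mem K)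
    change substitute (assignNone (solve S)) S ⊆ solve S
    rw [substitute_assignNone]
    refine Set.union_subset (Set.subset_add_left _ (zero_mem K)) ?_
    calc solve S + substitute (assignNone (solve S)) (derivative S)
        ⊆ (constants S + K) + K :=
          Set.add_subset_add_left (substitute_subset.trans increments_add_subset)
      _ = solve S := by rw [add_assoc, coe_add_coe, solve]
  · intro T hT
    obtain ⟨constants_subset, add_subset⟩ :=
      Set.union_subset_iff.1 ((substitute_assignNone T S).symm.subset.trans hT)
    have increments_subset : increments S ⊆ substitute (assignNone T) (derivative S) :=
      substitute_mono (assignNone_mono constants_subset) subset_rfl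
    rintro _ ⟨x, hx, y, hy, rfl⟩
    induction hy using AddSubmonoid.closure_induction_right with
    | zero => simpa using constants_subset hx
    | add_right y _ z hz ih =>
      change x + (y + z) ∈ T
      rw [← add_assoc]
      exact add_subset (Set.add_mem_add ih (increments_subset hz))

theorem derivative_mono {S T : Set (Multiset (Option α))} (h : S ⊆ T) :
    derivative S ⊆ derivative T :=
  fun _ hm => h hm

theorem derivative_add (S T : Set (Multiset (Option α))) :
    derivative (S + T) = (derivative S + T) ∪ (S + derivative T) := by
  ext d
  constructor
  · rintro ⟨m, hm, n, hn, h : m + n = none ::ₘ d⟩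
    have none_mem : none ∈ m + n := h ▸ Multiset.mem_cons_self none d
    rcases Multiset.mem_add.1 none_mem with none_mem | none_mem
    · obtain ⟨m, rfl⟩ := Multiset.exists_cons_of_mem none_mem
      exact .inl ⟨m, hm, n, hn, by simpa using h⟩
    · obtain ⟨n, rfl⟩ := Multiset.exists_cons_of_mem none_mem
      exact .inr ⟨m, hm, n, hn, by simpa using h⟩
  · rintro (⟨m, hm, n, hn, rfl⟩ | ⟨m, hm, n, hn, rfl⟩)
    · exact ⟨_, hm, _, hn, Multiset.cons_add _ _ _⟩
    · exact ⟨_, hm, _, hn, Multiset.add_cons _ _ _⟩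

theorem derivative_closure (S : Set (Multiset (Option α))) :
    derivative (AddSubmonoid.closure S) = derivative S + (AddSubmonoid.closure S : Set _) := by
  set K := AddSubmonoid.closure S
  have derivative_singleton_subset {m : Multiset (Option α)} (hm : m ∈ K) :
      derivative {m} ⊆ derivative S + K := by
    induction hm using AddSubmonoid.closure_induction with
    | mem m hm =>
      exact (derivative_mono (Set.singleton_subset_iff.2 hm)).trans
        (Set.subset_add_left _ (zero_mem K))
    | zero => exact fun d hd => absurd hd Multiset.cons_ne_zero
    | add m n hm hn ihm ihn =>
      rw [← Set.singleton_add_singleton, derivative_add, Set.union_subset_iff]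
      constructor
      · calc derivative {m} + {n} ⊆ (derivative S + K) + K :=
              Set.add_subset_add ihm (Set.singleton_subset_iff.2 hn)
          _ = derivative S + K := by rw [add_assoc, coe_add_coe]
      · calc {m} + derivative {n} ⊆ K + (derivative S + K) :=
              Set.add_subset_add (Set.singleton_subset_iff.2 hm) ihn
          _ = derivative S + K := by rw [add_left_comm, coe_add_coe]
  refine subset_antisymm (fun d hd => derivative_singleton_subset hd rfl) ?_
  calc derivative S + K ⊆ derivative (S + K) := by
        rw [derivative_add]; exact Set.subset_union_left
    _ ⊆ derivative (K + K) :=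
        derivative_mono (Set.add_subset_add_right AddSubmonoid.subset_closure)
    _ = derivative K := by rw [coe_add_coe]

theorem isSemilinearSet_derivative (hS : IsSemilinearSet S) : IsSemilinearSet (derivative S) := by
  induction hS using isSemilinearSet_induction with
  | empty => exact .empty
  | singleton m =>
    exact .of_finite ((Set.finite_singleton m).preimage
      fun _ _ _ _ => (Multiset.cons_inj_right none).1)
  | union S T _ _ hS hT => exact hS.union hT
  | add S T hS' hT' hS hT => rw [derivative_add]; exact (hS.add hT').union (hS'.add hT)
  | closure S hS' hS => rw [derivative_closure]; exact hS.add hS'.closure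

theorem isSemilinearSet_assignNone {T : Set (Multiset α)} (hT : IsSemilinearSet T) (c : Option α) :
    IsSemilinearSet (assignNone T c) := by
  cases c with
  | none => exact hT
  | some a => exact .singleton _

theorem isSemilinearSet_solve (hS : IsSemilinearSet S) : IsSemilinearSet (solve S) := by
  have constants_eq : constants S = substitute (assignNone ∅) S := by
    rw [substitute_assignNone]; simp
  have hC : IsSemilinearSet (constants S) :=
    constants_eq ▸ isSemilinearSet_substitute (isSemilinearSet_assignNone .empty) hS
  exact hC.add (isSemilinearSet_substitute (isSemilinearSet_assignNone hC)
    (isSemilinearSet_derivative hS)).closure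

end Equation

section System

variable {V α M : Type*} [AddCommMonoid M]

/-- The substitution of `N A` for the variables `A`; the letters of `α` are kept. -/
def assign (N : V → Set (Multiset α)) : V ⊕ α → Set (Multiset α) :=
  Sum.elim N fun a => {{a}}

/-- The families of languages that are closed under the productions `A → β` with `β ∈ P A`. -/
def preSolutions (P : V → Set (Multiset (V ⊕ α))) : Set (V → Set (Multiset α)) :=
  {N | ∀ A, substitute (assign N) (P A) ⊆ N A}

variable {P : V → Set (Multiset (V ⊕ α))} {N : V → Set (Multiset α)}

theorem mem_preSolutions :
    N ∈ preSolutions P ↔ ∀ A, ∀ β ∈ P A, (β.map (assign N)).sum ⊆ N A :=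
  forall_congr' fun _ => Set.iUnion₂_subset_iff

theorem sum_map_assign_inr (N : V → Set (Multiset α)) (x : Multiset α) :
    ((x.map Sum.inr).map (assign N)).sum = {x} := by
  rw [Multiset.map_map]
  exact sum_map_singleton_singleton x

theorem sum_map_assign_inr_add_inl (N : V → Set (Multiset α)) (x : Multiset α) (A : V) :
    ((x.map Sum.inr + {Sum.inl A}).map (assign N)).sum = x +ᵥ N A := by
  rw [Multiset.map_add, Multiset.sum_add, sum_map_assign_inr, Multiset.map_singleton,
    Multiset.sum_singleton, Set.singleton_add]
  rfl

theorem substitute_subset_of_isLeast (hN : IsLeast (preSolutions P) N) {ρ : α → Set M}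
    {N' : V → Set M} (hN' : ∀ A, substitute (Sum.elim N' ρ) (P A) ⊆ N' A) (A : V) :
    substitute ρ (N A) ⊆ N' A := by
  let R (A : V) : Set (Multiset α) := {m | (m.map ρ).sum ⊆ N' A}
  have substitute_R (A : V) : substitute ρ (R A) ⊆ N' A := Set.iUnion₂_subset fun _ hm => hm
  suffices hR : R ∈ preSolutions P from
    (substitute_mono (fun _ => subset_rfl) (hN.2 hR A)).trans (substitute_R A)
  intro A m hm
  calc (m.map ρ).sum ⊆ substitute ρ (substitute (assign R) (P A)) := sum_map_subset_substitute hm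
    _ = substitute (fun c => substitute ρ (assign R c)) (P A) := substitute_substitute _ _ _
    _ ⊆ substitute (Sum.elim N' ρ) (P A) := substitute_mono (fun c => by
        cases c with
        | inl B => exact substitute_R B
        | inr a => simp [assign]) subset_rfl
    _ ⊆ N' A := hN' A

theorem isSemilinearSet_assign (hN : ∀ A, IsSemilinearSet (N A)) (c : V ⊕ α) :
    IsSemilinearSet (assign N c) := by
  cases c with
  | inl A => exact hN A
  | inr a => exact .singleton _

/-- The system `P` with its variables renamed along `e`. -/
def renameVars {V' : Type*} (e : V ≃ V') (P : V' → Set (Multiset (V' ⊕ α))) (A : V) :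
    Set (Multiset (V ⊕ α)) :=
  Multiset.map (Sum.map e.symm id) '' P (e A)

theorem comp_mem_preSolutions_renameVars {V' : Type*} (e : V ≃ V')
    {P : V' → Set (Multiset (V' ⊕ α))} {N : V' → Set (Multiset α)} :
    N ∘ e ∈ preSolutions (renameVars e P) ↔ N ∈ preSolutions P := by
  have assign_comp : assign (N ∘ e) ∘ Sum.map e.symm id = assign N := by
    ext c : 1
    cases c <;> simp [assign]
  simp only [preSolutions, renameVars, Set.mem_ofPred_eq, substitute_image_map, assign_comp,
    Function.comp_apply, e.forall_congr_left, Equiv.apply_symm_apply]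

/-- The system `P` with the variable `none` regarded as a letter. -/
def freezeNone (P : Option V → Set (Multiset (Option V ⊕ α))) (A : Option V) :
    Set (Multiset (V ⊕ Option α)) :=
  Multiset.map
    (Sum.elim (fun B => B.elim (Sum.inr none) Sum.inl) fun a => Sum.inr (some a)) '' P A

/-- Solves the equation for the variable `none` after the other variables have been replaced by the
solutions `N` of their equations, which still contain `none` as a letter. -/
def solveNone (P : Option V → Set (Multiset (Option V ⊕ α))) (N : V → Set (Multiset (Option α))) :
    Set (Multiset α) :=
  solve (substitute (assign N) (freezeNone P none))

/-- The family of languages that consists of the solution for the variable `none` and of the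
solutions `N` of the other equations with that solution substituted for the letter `none`. -/
def backSubstitute (P : Option V → Set (Multiset (Option V ⊕ α)))
    (N : V → Set (Multiset (Option α))) (A : Option V) : Set (Multiset α) :=
  A.elim (solveNone P N) fun A => substitute (assignNone (solveNone P N)) (N A)

theorem substitute_freezeNone (T : Set (Multiset α)) (N : V → Set (Multiset (Option α)))
    (P : Option V → Set (Multiset (Option V ⊕ α))) (A : Option V) :
    substitute (assignNone T) (substitute (assign N) (freezeNone P A)) =
      substitute (assign fun B => B.elim T fun B => substitute (assignNone T) (N B)) (P A) := by
  rw [freezeNone, substitute_substitute, substitute_image_map]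
  congr 1
  ext c : 1
  rcases c with (_ | B) | a <;> simp [assign, assignNone]

theorem substitute_assign_freezeNone (T : Set (Multiset α)) (N : V → Set (Multiset α))
    (P : Option V → Set (Multiset (Option V ⊕ α))) (A : Option V) :
    substitute (Sum.elim N (assignNone T)) (freezeNone P A) =
      substitute (assign fun B => B.elim T N) (P A) := by
  rw [freezeNone, substitute_image_map]
  congr 1
  ext c : 1
  rcases c with (_ | B) | a <;> simp [assign, assignNone]

theorem isLeast_backSubstitute {P : Option V → Set (Multiset (Option V ⊕ α))}
    {N : V → Set (Multiset (Option α))}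
    (hN : IsLeast (preSolutions fun A => freezeNone P (some A)) N) :
    IsLeast (preSolutions P) (backSubstitute P N) := by
  have hT := isLeast_solve (substitute (assign N) (freezeNone P none))
  constructor
  · intro A
    refine (substitute_freezeNone _ N P A).symm.subset.trans ?_
    cases A with
    | none => exact hT.1
    | some A => exact substitute_mono (fun _ => subset_rfl) (hN.1 A)
  · intro N' hN'
    obtain ⟨T', N', rfl⟩ : ∃ (T' : Set (Multiset α)) (N'' : V → Set (Multiset α)),
        N' = fun B => B.elim T' N'' := ⟨N' none, fun A => N' (some A), by ext (_ | A) : 1 <;> rfl⟩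
    have substitute_subset (A : V) : substitute (assignNone T') (N A) ⊆ N' A :=
      substitute_subset_of_isLeast hN
        (fun A => (substitute_assign_freezeNone T' N' P (some A)).subset.trans (hN' (some A))) A
    have solve_subset : solveNone P N ⊆ T' := hT.2 <| by
      refine Set.Subset.trans ?_ (hN' none)
      refine (substitute_freezeNone T' N P none).subset.trans (substitute_mono ?_ subset_rfl)
      rintro ((_ | B) | a)
      exacts [subset_rfl, substitute_subset B, subset_rfl]
    rintro (_ | A)
    · exact solve_subset
    · exact (substitute_mono (assignNone_mono solve_subset) subset_rfl).trans (substitute_subset A)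

theorem isSemilinearSet_backSubstitute {P : Option V → Set (Multiset (Option V ⊕ α))}
    {N : V → Set (Multiset (Option α))} (hP : IsSemilinearSet (P none))
    (hN : ∀ A, IsSemilinearSet (N A)) (A : Option V) : IsSemilinearSet (backSubstitute P N A) := by
  have hT : IsSemilinearSet (solveNone P N) := isSemilinearSet_solve
    (isSemilinearSet_substitute (isSemilinearSet_assign hN) (isSemilinearSet_image_map _ hP))
  cases A with
  | none => exact hT
  | some A => exact isSemilinearSet_substitute (isSemilinearSet_assignNone hT) (hN A)

theorem exists_isLeast_preSolutions [Finite V] (hP : ∀ A, IsSemilinearSet (P A)) :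
    ∃ N, (∀ A, IsSemilinearSet (N A)) ∧ IsLeast (preSolutions P) N := by
  induction V using Finite.induction_empty_option generalizing α with
  | of_equiv e ih =>
    obtain ⟨N, hN, hN_least⟩ := ih (P := renameVars e P) fun A => isSemilinearSet_image_map _ (hP _)
    obtain ⟨N, rfl⟩ : ∃ N', N' ∘ e = N := ⟨N ∘ e.symm, by simp [Function.comp_assoc]⟩
    refine ⟨N, e.forall_congr_right.1 hN, (comp_mem_preSolutions_renameVars e).1 hN_least.1, ?_⟩
    intro N' hN'
    exact e.forall_congr_right.1 (hN_least.2 ((comp_mem_preSolutions_renameVars e).2 hN'))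
  | h_empty => exact ⟨isEmptyElim, isEmptyElim, isEmptyElim, fun _ _ => isEmptyElim⟩
  | h_option ih =>
    obtain ⟨N, hN, hN_least⟩ := ih (P := fun A => freezeNone P (some A)) fun A =>
      isSemilinearSet_image_map _ (hP _)
    exact ⟨backSubstitute P N, isSemilinearSet_backSubstitute (hP none) hN,
      isLeast_backSubstitute hN_least⟩

theorem isSemilinearSet_of_isLeast [Finite V] (hP : ∀ A, IsSemilinearSet (P A))
    (hN : IsLeast (preSolutions P) N) (A : V) : IsSemilinearSet (N A) := by
  obtain ⟨N', hN', hN'_least⟩ := exists_isLeast_preSolutions hP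
  exact hN.unique hN'_least ▸ hN' A

end System

namespace ParallelGrammar

variable {α : Type*} {G : ParallelGrammar α}

/-- The words over the terminals that are derivable from the variable `A`. -/
def languageFrom (G : ParallelGrammar α) (A : G.Var) : Set (ParWord α) :=
  {w | Relation.ReflTransGen G.Step {Sum.inl A} (w.map Sum.inr)}

/-- The right-hand sides of the productions of the variable `A`. -/
def bodies (G : ParallelGrammar α) (A : G.Var) : Set (ParWord (G.Var ⊕ α)) :=
  {β | (A, β) ∈ G.prods}

theorem reflTransGen_step_add {u v u' v' : ParWord (G.Var ⊕ α)}
    (h : Relation.ReflTransGen G.Step u v) (h' : Relation.ReflTransGen G.Step u' v') :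
    Relation.ReflTransGen G.Step (u + u') (v + v') := by
  have step_add {u v : ParWord (G.Var ⊕ α)} (w) (h : G.Step u v) : G.Step (u + w) (v + w) := by
    obtain ⟨A, β, γ, hA, rfl, rfl⟩ := h
    exact ⟨A, β, γ + w, hA, add_assoc _ _ _, add_assoc _ _ _⟩
  refine (h.lift (· + u') fun _ _ => step_add u').trans ?_
  simpa only [add_comm v] using h'.lift (· + v) fun _ _ => step_add v

theorem languageFrom_mem_preSolutions : G.languageFrom ∈ preSolutions G.bodies := by
  have derives_of_mem (β : ParWord (G.Var ⊕ α)) {w : ParWord α}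
      (hw : w ∈ (β.map (assign G.languageFrom)).sum) :
      Relation.ReflTransGen G.Step β (w.map Sum.inr) := by
    induction β using Multiset.induction_on generalizing w with
    | empty => rw [Set.mem_zero.1 hw]; exact .refl
    | cons c β ih =>
      rw [Multiset.map_cons, Multiset.sum_cons] at hw
      obtain ⟨y, hy, z, hz, rfl⟩ := hw
      rw [← Multiset.singleton_add, Multiset.map_add]
      refine reflTransGen_step_add ?_ (ih hz)
      cases c with
      | inl B => exact hy
      | inr a => rw [Set.mem_singleton_iff.1 hy]; exact .refl
  rintro A w hw
  obtain ⟨β, hβ, hw⟩ := mem_substitute.1 hw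
  exact .head ⟨A, β, 0, hβ, (add_zero _).symm, (add_zero _).symm⟩ (derives_of_mem β hw)

theorem languageFrom_subset {N : G.Var → Set (ParWord α)} (hN : N ∈ preSolutions G.bodies)
    (A : G.Var) : G.languageFrom A ⊆ N A := by
  have mem_of_derives {u : ParWord (G.Var ⊕ α)} {w : ParWord α}
      (h : Relation.ReflTransGen G.Step u (w.map Sum.inr)) : w ∈ (u.map (assign N)).sum := by
    induction h using Relation.ReflTransGen.head_induction_on with
    | refl => rw [sum_map_assign_inr]; rfl
    | head h _ ih =>
      obtain ⟨A, β, γ, hβ, rfl, rfl⟩ := h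
      rw [Multiset.map_add, Multiset.sum_add] at ih ⊢
      refine Set.add_subset_add_right ?_ ih
      simpa [assign] using (sum_map_subset_substitute hβ).trans (hN A)
  exact fun w hw => by simpa [assign] using mem_of_derives hw

theorem isLeast_languageFrom (G : ParallelGrammar α) :
    IsLeast (preSolutions G.bodies) G.languageFrom :=
  ⟨languageFrom_mem_preSolutions, fun _ hN => languageFrom_subset hN⟩

theorem isSemilinearSet_language (G : ParallelGrammar α) : IsSemilinearSet G.language :=
  have := G.finite_var
  have finite_bodies (A : G.Var) : (G.bodies A).Finite :=
    G.finite_prods.preimage (Prod.mk_right_injective A).injOn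
  isSemilinearSet_of_isLeast (fun A => .of_finite (finite_bodies A)) G.isLeast_languageFrom G.start

end ParallelGrammar

section LinearGrammar

variable {α : Type*} {n : ℕ}

/-- A linear grammar for `⋃ i, v i +ᵥ closure (F i)`: the start variable `none` chooses `i` and
emits `v i`, then the variable `some i` emits words of `F i` until it is erased. -/
def linearGrammar (v : Fin n → ParWord α) (F : Fin n → Finset (ParWord α)) :
    ParallelGrammar α where
  Var := Option (Fin n)
  finite_var := inferInstance
  prods :=
    (Set.range fun i => (none, (v i).map Sum.inr + {Sum.inl (some i)})) ∪
      (⋃ i, (fun f => (some i, f.map Sum.inr + {Sum.inl (some i)})) '' (F i : Set (ParWord α))) ∪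
      Set.range fun i => (some i, (0 : ParWord α).map Sum.inr)
  finite_prods := ((Set.finite_range _).union
    (Set.finite_iUnion fun i => (F i).finite_toSet.image _)).union (Set.finite_range _)
  start := none

variable (v : Fin n → ParWord α) (F : Fin n → Finset (ParWord α))

theorem isLinear_linearGrammar : (linearGrammar v F).IsLinear := by
  rintro A β ((⟨i, ⟨⟩⟩ | hβ) | ⟨i, ⟨⟩⟩)
  · exact .inl ⟨_, _, rfl⟩
  · obtain ⟨i, f, -, ⟨⟩⟩ := Set.mem_iUnion.1 hβ
    exact .inl ⟨_, _, rfl⟩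
  · exact .inr ⟨_, rfl⟩

theorem mem_preSolutions_linearGrammar {N : Option (Fin n) → Set (ParWord α)} :
    N ∈ preSolutions (linearGrammar v F).bodies ↔
      ∀ i, v i +ᵥ N (some i) ⊆ N none ∧ (∀ f ∈ F i, f +ᵥ N (some i) ⊆ N (some i)) ∧
        0 ∈ N (some i) := by
  refine mem_preSolutions.trans ⟨fun h i => ⟨?_, fun f hf => ?_, ?_⟩, ?_⟩
  · rw [← sum_map_assign_inr_add_inl]
    exact h none _ (.inl (.inl ⟨i, rfl⟩))
  · rw [← sum_map_assign_inr_add_inl]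
    exact h (some i) _ (.inl (.inr (Set.mem_iUnion.2 ⟨i, f, hf, rfl⟩)))
  · rw [← Set.singleton_subset_iff, ← sum_map_assign_inr N]
    exact h (some i) _ (.inr ⟨i, rfl⟩)
  · rintro h A β ((⟨i, ⟨⟩⟩ | hβ) | ⟨i, ⟨⟩⟩)
    · exact (sum_map_assign_inr_add_inl N _ _).subset.trans (h i).1
    · obtain ⟨i, f, hf, ⟨⟩⟩ := Set.mem_iUnion.1 hβ
      exact (sum_map_assign_inr_add_inl N _ _).subset.trans ((h i).2.1 f hf)
    · exact (sum_map_assign_inr N _).subset.trans (Set.singleton_subset_iff.2 (h i).2.2)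

theorem language_linearGrammar :
    (linearGrammar v F).language =
      ⋃ i, v i +ᵥ (AddSubmonoid.closure (F i : Set (ParWord α)) : Set (ParWord α)) := by
  apply subset_antisymm
  · let N (A : Option (Fin n)) : Set (ParWord α) :=
      A.elim (⋃ i, v i +ᵥ (AddSubmonoid.closure (F i : Set (ParWord α)) : Set (ParWord α)))
        fun i => AddSubmonoid.closure (F i : Set (ParWord α))
    have hN : N ∈ preSolutions (linearGrammar v F).bodies := by
      refine (mem_preSolutions_linearGrammar v F).2 fun i =>
        ⟨Set.subset_iUnion (fun i => v i +ᵥ N (some i)) i, ?_, zero_mem _⟩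
      rintro f hf _ ⟨w, hw, rfl⟩
      exact add_mem (AddSubmonoid.subset_closure hf) hw
    exact ParallelGrammar.languageFrom_subset hN none
  · refine Set.iUnion_subset fun i => ?_
    obtain ⟨vadd_subset, add_subset, zero_mem⟩ :=
      (mem_preSolutions_linearGrammar v F).1 ParallelGrammar.languageFrom_mem_preSolutions i
    refine (Set.vadd_set_mono fun w hw => ?_).trans vadd_subset
    induction hw using AddSubmonoid.closure_induction_left with
    | zero => exact zero_mem
    | add_left f hf w _ ih => exact add_subset f hf (Set.vadd_mem_vadd_set ih)

theorem exists_isLinear_language_eq {L : Set (ParWord α)} (hL : IsSemilinearSet L) :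
    ∃ G : ParallelGrammar α, G.IsLinear ∧ G.language = L := by
  obtain ⟨n, v, F, rfl⟩ := exists_eq_iUnion_vadd_closure hL
  exact ⟨linearGrammar v F, isLinear_linearGrammar v F, language_linearGrammar v F⟩

end LinearGrammar

namespace SPTerm

variable {α : Type*}

/-- The multiset of letters of a term. -/
def letters : SPTerm α → Multiset α
  | empty => 0
  | letter a => {a}
  | seq x y => x.letters + y.letters
  | par x y => x.letters + y.letters

/-- A term without a sequential composition of two nonempty words. -/
def IsPar : SPTerm α → Prop
  | empty => True
  | letter _ => True
  | seq x y => (x.letters = 0 ∨ y.letters = 0) ∧ x.IsPar ∧ y.IsPar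
  | par x y => x.IsPar ∧ y.IsPar

theorem Equiv.letters_eq {x y : SPTerm α} (h : Equiv x y) : x.letters = y.letters := by
  induction h with
  | refl => rfl
  | symm _ ih => exact ih.symm
  | trans _ _ ih ih' => exact ih.trans ih'
  | seq_congr _ _ ih ih' => simp [letters, ih, ih']
  | par_congr _ _ ih ih' => simp [letters, ih, ih']
  | seq_assoc => simp [letters, add_assoc]
  | empty_seq => simp [letters]
  | seq_empty => simp [letters]
  | par_assoc => simp [letters, add_assoc]
  | par_comm => simp [letters, add_comm]
  | empty_par => simp [letters]

theorem Equiv.isPar_iff {x y : SPTerm α} (h : Equiv x y) : x.IsPar ↔ y.IsPar := by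
  induction h with
  | refl => rfl
  | symm _ ih => exact ih.symm
  | trans _ _ ih ih' => exact ih.trans ih'
  | seq_congr h h' ih ih' => simp [IsPar, ih, ih', h.letters_eq, h'.letters_eq]
  | par_congr _ _ ih ih' => simp [IsPar, ih, ih']
  | seq_assoc => simp only [IsPar, letters, add_eq_zero]; tauto
  | empty_seq => simp [IsPar, letters]
  | seq_empty => simp [IsPar, letters]
  | par_assoc => simp only [IsPar]; tauto
  | par_comm => simp only [IsPar]; tauto
  | empty_par => simp [IsPar]

end SPTerm

namespace SPWord

variable {α : Type*}

/-- The multiset of letters of a series-parallel word. -/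
def letters (x : SPWord α) : Multiset α :=
  Quotient.lift SPTerm.letters (fun _ _ => SPTerm.Equiv.letters_eq) x

/-- A word that is not a sequential composition of nonempty words, and whose parallel components
are not either. -/
def IsPar (x : SPWord α) : Prop :=
  Quotient.lift SPTerm.IsPar (fun _ _ h => propext (SPTerm.Equiv.isPar_iff h)) x

@[simp] theorem letters_letter (a : α) : (letter a).letters = {a} := rfl

@[simp] theorem letters_seq (x y : SPWord α) : (seq x y).letters = x.letters + y.letters := by
  induction x using Quotient.inductionOn
  induction y using Quotient.inductionOn
  rfl

@[simp] theorem letters_par (x y : SPWord α) : (par x y).letters = x.letters + y.letters := by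
  induction x using Quotient.inductionOn
  induction y using Quotient.inductionOn
  rfl

theorem isPar_empty : (empty : SPWord α).IsPar := trivial

theorem isPar_letter (a : α) : (letter a).IsPar := trivial

theorem isPar_seq {x y : SPWord α} :
    (seq x y).IsPar ↔ (x.letters = 0 ∨ y.letters = 0) ∧ x.IsPar ∧ y.IsPar := by
  induction x using Quotient.inductionOn
  induction y using Quotient.inductionOn
  rfl

theorem isPar_par {x y : SPWord α} : (par x y).IsPar ↔ x.IsPar ∧ y.IsPar := by
  induction x using Quotient.inductionOn
  induction y using Quotient.inductionOn
  rfl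

@[simp] theorem letters_foldr_par (xs : List (SPWord α)) :
    (xs.foldr par empty).letters = (xs.map letters).sum := by
  induction xs with
  | nil => rfl
  | cons x xs ih => rw [List.foldr_cons, letters_par, ih, List.map_cons, List.sum_cons]

theorem isPar_foldr_par {xs : List (SPWord α)} :
    (xs.foldr par empty).IsPar ↔ ∀ x ∈ xs, x.IsPar := by
  induction xs with
  | nil => simp [isPar_empty]
  | cons x xs ih => rw [List.foldr_cons, isPar_par, ih, List.forall_mem_cons]

@[simp] theorem empty_seq (x : SPWord α) : seq empty x = x := by
  induction x using Quotient.inductionOn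
  exact Quotient.sound (.empty_seq _)

@[simp] theorem seq_empty (x : SPWord α) : seq x empty = x := by
  induction x using Quotient.inductionOn
  exact Quotient.sound (.seq_empty _)

@[simp] theorem empty_par (x : SPWord α) : par empty x = x := by
  induction x using Quotient.inductionOn
  exact Quotient.sound (.empty_par _)

@[simp] theorem par_empty (x : SPWord α) : par x empty = x := by
  rw [par_comm, empty_par]

theorem induction {p : SPWord α → Prop} (empty : p empty) (letter : ∀ a, p (letter a))
    (seq : ∀ x y, p x → p y → p (seq x y)) (par : ∀ x y, p x → p y → p (par x y))
    (x : SPWord α) : p x := by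
  induction x using Quotient.inductionOn with
  | h t =>
    induction t with
    | empty => exact empty
    | letter a => exact letter a
    | seq x y ihx ihy => exact seq _ _ ihx ihy
    | par x y ihx ihy => exact par _ _ ihx ihy

theorem eq_empty_of_letters_eq_zero {x : SPWord α} (h : x.letters = 0) : x = empty := by
  induction x using SPWord.induction with
  | empty => rfl
  | letter a => simp at h
  | seq x y ihx ihy =>
    rw [letters_seq, add_eq_zero] at h
    rw [ihx h.1, ihy h.2, empty_seq]
  | par x y ihx ihy =>
    rw [letters_par, add_eq_zero] at h
    rw [ihx h.1, ihy h.2, empty_par]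

end SPWord

namespace ParWord

open SPWord

variable {α : Type*}

@[simp] theorem toSP_zero : (0 : ParWord α).toSP = empty := rfl

@[simp] theorem toSP_cons (a : α) (w : ParWord α) : toSP (a ::ₘ w) = par (letter a) w.toSP :=
  Multiset.foldr_cons _ _ _ _

@[simp] theorem toSP_singleton (a : α) : toSP {a} = letter a := by
  rw [← Multiset.cons_zero, toSP_cons, toSP_zero, par_empty]

theorem toSP_add (v w : ParWord α) : toSP (v + w) = par v.toSP w.toSP := by
  induction v using Multiset.induction_on with
  | empty => simp
  | cons a v ih => rw [Multiset.cons_add, toSP_cons, ih, toSP_cons, par_assoc]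

@[simp] theorem letters_toSP (w : ParWord α) : w.toSP.letters = w := by
  induction w using Multiset.induction_on with
  | empty => rfl
  | cons a w ih => rw [toSP_cons, letters_par, ih, letters_letter, Multiset.singleton_add]

theorem toSP_injective : Function.Injective (toSP : ParWord α → SPWord α) :=
  Function.LeftInverse.injective letters_toSP

theorem isPar_toSP (w : ParWord α) : w.toSP.IsPar := by
  induction w using Multiset.induction_on with
  | empty => exact isPar_empty
  | cons a w ih => rw [toSP_cons]; exact isPar_par.2 ⟨isPar_letter a, ih⟩

theorem toSP_letters {x : SPWord α} (h : x.IsPar) : toSP x.letters = x := by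
  induction x using SPWord.induction with
  | empty => rfl
  | letter a => simp
  | seq x y ihx ihy =>
    obtain ⟨h | h, hx, hy⟩ := isPar_seq.1 h
    · rw [letters_seq, h, zero_add, ihy hy, eq_empty_of_letters_eq_zero h, empty_seq]
    · rw [letters_seq, h, add_zero, ihx hx, eq_empty_of_letters_eq_zero h, seq_empty]
  | par x y ihx ihy =>
    obtain ⟨hx, hy⟩ := isPar_par.1 h
    rw [letters_par, toSP_add, ihx hx, ihy hy]

theorem seq_eq_toSP {x y : SPWord α} {w : ParWord α} (h : seq x y = w.toSP) :
    (x = empty ∧ y = w.toSP) ∨ (x = w.toSP ∧ y = empty) := by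
  have hp : (seq x y).IsPar := h ▸ isPar_toSP w
  rcases (isPar_seq.1 hp).1 with hx | hy
  · rw [eq_empty_of_letters_eq_zero hx, empty_seq] at h
    exact .inl ⟨eq_empty_of_letters_eq_zero hx, h⟩
  · rw [eq_empty_of_letters_eq_zero hy, seq_empty] at h
    exact .inr ⟨h, eq_empty_of_letters_eq_zero hy⟩

theorem par_eq_toSP {x y : SPWord α} {w : ParWord α} (h : par x y = w.toSP) :
    ∃ u v : ParWord α, x = u.toSP ∧ y = v.toSP ∧ w = u + v := by
  have hp : (par x y).IsPar := h ▸ isPar_toSP w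
  obtain ⟨hx, hy⟩ := isPar_par.1 hp
  refine ⟨x.letters, y.letters, (toSP_letters hx).symm, (toSP_letters hy).symm, ?_⟩
  rw [← letters_par, h, letters_toSP]

end ParWord

section Rational

open ParWord

variable {α : Type*}

theorem image_toSP_add (L₁ L₂ : Set (ParWord α)) :
    toSP '' (L₁ + L₂) = parLang (toSP '' L₁) (toSP '' L₂) := by
  rw [← Set.image2_add, Set.image_image2, parLang, Set.image2_image_left, Set.image2_image_right]
  simp only [toSP_add]

theorem parPow_image_toSP (L : Set (ParWord α)) (n : ℕ) :
    parPow (toSP '' L) n = toSP '' (n • L) := by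
  induction n with
  | zero => rw [zero_nsmul, ← Set.singleton_zero, Set.image_singleton, toSP_zero, parPow]
  | succ n ih => rw [succ_nsmul, image_toSP_add, ← ih, parPow]

theorem parStar_image_toSP (L : Set (ParWord α)) :
    parStar (toSP '' L) = toSP '' (AddSubmonoid.closure L : Set (ParWord α)) := by
  simp only [parStar, parPow_image_toSP, coe_closure_eq_iUnion_nsmul, Set.image_iUnion]

theorem isParallelRational_singleton_toSP (w : ParWord α) :
    IsParallelRational ({w.toSP} : Set (SPWord α)) := by
  induction w using Multiset.induction_on with
  | empty =>
    have h : IsParallelRational (parStar (toSP '' (∅ : Set (ParWord α)))) := by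
      rw [Set.image_empty]
      exact .parStar .empty
    rw [parStar_image_toSP] at h
    simpa using h
  | cons a w ih =>
    have h := IsParallelRational.par (.letter a) ih
    rwa [parLang, Set.image2_singleton, ← toSP_cons] at h

theorem isParallelRegular_of_isSemilinearSet {L : Set (ParWord α)} (hL : IsSemilinearSet L) :
    IsParallelRegular L := by
  unfold IsParallelRegular
  induction hL using isSemilinearSet_induction with
  | empty => rw [Set.image_empty]; exact .empty
  | singleton w => rw [Set.image_singleton]; exact isParallelRational_singleton_toSP w
  | union s t _ _ hs ht => rw [Set.image_union]; exact .union hs ht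
  | add s t _ _ hs ht => rw [image_toSP_add]; exact .par hs ht
  | closure s _ hs => rw [← parStar_image_toSP]; exact .parStar hs

theorem preimage_toSP_seqLang (K₁ K₂ : Set (SPWord α)) :
    toSP ⁻¹' seqLang K₁ K₂ = {w | SPWord.empty ∈ K₁ ∧ w ∈ toSP ⁻¹' K₂} ∪
      {w | SPWord.empty ∈ K₂ ∧ w ∈ toSP ⁻¹' K₁} := by
  ext w
  constructor
  · rintro ⟨x, hx, y, hy, h⟩
    rcases seq_eq_toSP h with ⟨rfl, rfl⟩ | ⟨rfl, rfl⟩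
    · exact .inl ⟨hx, hy⟩
    · exact .inr ⟨hy, hx⟩
  · rintro (⟨h, hw⟩ | ⟨h, hw⟩)
    · exact ⟨_, h, _, hw, SPWord.empty_seq _⟩
    · exact ⟨_, hw, _, h, SPWord.seq_empty _⟩

theorem preimage_toSP_parLang (K₁ K₂ : Set (SPWord α)) :
    toSP ⁻¹' parLang K₁ K₂ = toSP ⁻¹' K₁ + toSP ⁻¹' K₂ := by
  ext w
  constructor
  · rintro ⟨x, hx, y, hy, h⟩
    obtain ⟨u, v, rfl, rfl, rfl⟩ := par_eq_toSP h
    exact ⟨u, hx, v, hy, rfl⟩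
  · rintro ⟨u, hu, v, hv, rfl⟩
    exact ⟨_, hu, _, hv, (toSP_add u v).symm⟩

theorem preimage_toSP_parPow (K : Set (SPWord α)) (n : ℕ) :
    toSP ⁻¹' parPow K n = n • (toSP ⁻¹' K) := by
  induction n with
  | zero =>
    ext w
    exact toSP_injective.eq_iff' toSP_zero
  | succ n ih => rw [parPow, preimage_toSP_parLang, ih, succ_nsmul]

theorem preimage_toSP_parStar (K : Set (SPWord α)) :
    toSP ⁻¹' parStar K = (AddSubmonoid.closure (toSP ⁻¹' K) : Set (ParWord α)) := by
  simp only [parStar, Set.preimage_iUnion, preimage_toSP_parPow, coe_closure_eq_iUnion_nsmul]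

theorem isSemilinearSet_preimage_toSP {K : Set (SPWord α)} (hK : IsParallelRational K) :
    IsSemilinearSet (toSP ⁻¹' K) := by
  have sep {L : Set (ParWord α)} (p : Prop) (hL : IsSemilinearSet L) :
      IsSemilinearSet {w | p ∧ w ∈ L} := by
    by_cases hp : p <;> simp [hp, hL]
  induction hK with
  | empty => exact .empty
  | letter a =>
    rw [← toSP_singleton, ← Set.image_singleton, Set.preimage_image_eq _ toSP_injective]
    exact .singleton _
  | union _ _ ih ih' => exact ih.union ih'
  | seq _ _ ih ih' => rw [preimage_toSP_seqLang]; exact (sep _ ih').union (sep _ ih)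
  | par _ _ ih ih' => rw [preimage_toSP_parLang]; exact ih.add ih'
  | parStar _ ih => rw [preimage_toSP_parStar]; exact ih.closure

theorem isParallelRegular_iff_isSemilinearSet {L : Set (ParWord α)} :
    IsParallelRegular L ↔ IsSemilinearSet L := by
  refine ⟨fun hL => ?_, isParallelRegular_of_isSemilinearSet⟩
  rw [← Set.preimage_image_eq L toSP_injective]
  exact isSemilinearSet_preimage_toSP hL

end Rational

section SemilinearAutomaton

open ParWord

variable {α : Type*} {n : ℕ}

/-- The two parallel branches into which `semilinearAutomaton` splits the branch `j`. -/
def branches (j : Fin n × Bool) : Multiset (Fin n × Bool) := {(j.1, false), j}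

/-- The words that the branch `j` of `semilinearAutomaton` may read without splitting. -/
def branchWords (v : Fin n → ParWord α) (F : Fin n → Finset (ParWord α)) :
    Fin n × Bool → Set (ParWord α)
  | (i, true) => {v i}
  | (i, false) => insert 0 (F i)

/-- The words that the branch `j` of `semilinearAutomaton` may read. -/
def branchLanguage (v : Fin n → ParWord α) (F : Fin n → Finset (ParWord α)) :
    Fin n × Bool → Set (ParWord α)
  | (i, true) => v i +ᵥ (AddSubmonoid.closure (F i : Set (ParWord α)) : Set (ParWord α))
  | (i, false) => AddSubmonoid.closure (F i : Set (ParWord α))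

variable (v : Fin n → ParWord α) (F : Fin n → Finset (ParWord α))

theorem finite_branchWords (j : Fin n × Bool) : (branchWords v F j).Finite := by
  obtain ⟨i, _ | _⟩ := j
  · exact (F i).finite_toSet.insert 0
  · exact Set.finite_singleton (v i)

theorem branches_injective : Function.Injective (branches : Fin n × Bool → _) := by
  rintro ⟨i, k⟩ ⟨i', k'⟩ h
  obtain rfl : i = i' := by simpa [branches] using congrArg (i ∈ ·.map Prod.fst) h
  exact Multiset.singleton_inj.1 ((Multiset.cons_inj_right _).1 h)

theorem branchWords_subset_branchLanguage (j : Fin n × Bool) :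
    branchWords v F j ⊆ branchLanguage v F j := by
  obtain ⟨i, _ | _⟩ := j
  · exact Set.insert_subset (zero_mem _) AddSubmonoid.subset_closure
  · exact Set.singleton_subset_iff.2 ⟨0, zero_mem _, add_zero _⟩

theorem branchLanguage_add_subset (j : Fin n × Bool) :
    branchLanguage v F (j.1, false) + branchLanguage v F j ⊆ branchLanguage v F j := by
  obtain ⟨i, _ | _⟩ := j
  · exact (coe_add_coe _).subset
  · rintro _ ⟨w, hw, _, ⟨w', hw', rfl⟩, rfl⟩
    exact ⟨w + w', add_mem hw hw', add_left_comm _ _ _⟩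

variable {v F}

theorem branchLanguage_subset {R : Fin n × Bool → Set (ParWord α)}
    (hwords : ∀ j, branchWords v F j ⊆ R j) (hadd : ∀ j, R (j.1, false) + R j ⊆ R j)
    (j : Fin n × Bool) : branchLanguage v F j ⊆ R j := by
  have closure_subset (i : Fin n) : branchLanguage v F (i, false) ⊆ R (i, false) := fun w hw => by
    induction hw using AddSubmonoid.closure_induction_left with
    | zero => exact hwords _ (Set.mem_insert _ _)
    | add_left f hf w _ ih =>
      exact hadd (i, false) (Set.add_mem_add (hwords _ (Set.mem_insert_of_mem _ hf)) ih)
  obtain ⟨i, _ | _⟩ := j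
  · exact closure_subset i
  · rintro _ ⟨w, hw, rfl⟩
    change v i + w ∈ R (i, true)
    rw [add_comm]
    exact hadd (i, true) (Set.add_mem_add (closure_subset i hw) (hwords (i, true) rfl))

variable (v F)

/-- A branching automaton for `⋃ i, v i +ᵥ closure (F i)`. A state is a branch `j` together with a
flag that tells whether the branch is finished. The branch `(i, true)` reads `v i` and may split off
any number of branches `(i, false)`, which read words of `F i`, or nothing, and may split too. -/
def semilinearAutomaton : BranchingAutomaton α where
  State := (Fin n × Bool) × Bool
  finite_state := inferInstance
  seqTrans := ∅
  forkTrans := Set.range fun j => ((j, false), (branches j).map (·, false))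
  joinTrans := Set.range fun j => ((branches j).map (·, true), (j, true))
  parTrans := ⋃ j, (fun w => (((j, false), (branches j).map (·, false)), w,
    ((branches j).map (·, true), (j, true)))) '' branchWords v F j
  finite_seq := Set.finite_empty
  finite_fork := Set.finite_range _
  finite_join := Set.finite_range _
  finite_par := Set.finite_iUnion fun j => (finite_branchWords v F j).image _
  two_le_card_fork := by rintro _ ⟨j, rfl⟩; simp [branches]
  two_le_card_join := by rintro _ ⟨j, rfl⟩; simp [branches]
  par_subset t ht := by
    obtain ⟨j, w, -, rfl⟩ := Set.mem_iUnion.1 ht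
    exact ⟨⟨j, rfl⟩, ⟨j, rfl⟩⟩
  start := Set.range fun i => ((i, true), false)
  final := Set.range fun i => ((i, true), true)

variable {v F}

/-- What a run of `semilinearAutomaton v F` from `p` to `q` labelled `x` can be: a trivial run, or
the run of a whole branch. -/
def IsBranchRun (v : Fin n → ParWord α) (F : Fin n → Finset (ParWord α)) (p : (Fin n × Bool) × Bool)
    (x : SPWord α) (q : (Fin n × Bool) × Bool) : Prop :=
  (p = q ∧ x = SPWord.empty) ∨
    ∃ j, p = (j, false) ∧ q = (j, true) ∧ ∃ w ∈ branchLanguage v F j, w.toSP = x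

theorem IsBranchRun.exists_mem_branchLanguage {p q : (Fin n × Bool) × Bool} {x : SPWord α}
    (h : IsBranchRun v F p x q) (hp : p.2 = false) (hq : q.2 = true) :
    q.1 = p.1 ∧ ∃ w ∈ branchLanguage v F p.1, w.toSP = x := by
  obtain ⟨rfl, -⟩ | ⟨j, rfl, rfl, hx⟩ := h
  · exact absurd (hp.symm.trans hq) Bool.false_ne_true
  · exact ⟨rfl, hx⟩

theorem isBranchRun_fork {j j' : Fin n × Bool}
    {l : List (((Fin n × Bool) × Bool) × SPWord α × ((Fin n × Bool) × Bool))}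
    (hstart : (branches j).map (·, false) = ↑(l.map fun t => t.1))
    (hend : (branches j').map (·, true) = ↑(l.map fun t => t.2.2))
    (hl : ∀ t ∈ l, IsBranchRun v F t.1 t.2.1 t.2.2) :
    IsBranchRun v F (j, false) ((l.map fun t => t.2.1).foldr SPWord.par SPWord.empty)
      (j', true) := by
  have isBranch (t) (ht : t ∈ l) :
      t.2.2.1 = t.1.1 ∧ ∃ w ∈ branchLanguage v F t.1.1, w.toSP = t.2.1 := by
    have start_mem : t.1 ∈ (branches j).map (·, false) :=
      hstart ▸ List.mem_map_of_mem (f := fun t => t.1) ht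
    have end_mem : t.2.2 ∈ (branches j').map (·, true) :=
      hend ▸ List.mem_map_of_mem (f := fun t => t.2.2) ht
    obtain ⟨_, -, hk⟩ := Multiset.mem_map.1 start_mem
    obtain ⟨_, -, hk'⟩ := Multiset.mem_map.1 end_mem
    exact (hl t ht).exists_mem_branchLanguage (hk ▸ rfl) (hk' ▸ rfl)
  have branches_eq : branches j = ↑(l.map fun t => t.1.1) := by
    simpa [Function.comp_def] using congrArg (Multiset.map Prod.fst) hstart
  have branches_eq' : branches j' = ↑(l.map fun t => t.2.2.1) := by
    simpa [Function.comp_def] using congrArg (Multiset.map Prod.fst) hend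
  obtain rfl : j' = j := branches_injective <| by
    rw [branches_eq, branches_eq', List.map_congr_left fun t ht => (isBranch t ht).1]
  have sum_eq : branchLanguage v F (j'.1, false) + branchLanguage v F j' =
      (l.map fun t => branchLanguage v F t.1.1).sum := by
    simpa [branches, Function.comp_def] using
      congrArg (fun m => (m.map (branchLanguage v F)).sum) branches_eq
  refine .inr ⟨j', rfl, rfl, _, branchLanguage_add_subset v F j' ?_, toSP_letters ?_⟩
  · rw [SPWord.letters_foldr_par, List.map_map, sum_eq]
    refine Set.list_sum_mem_list_sum l _ _ fun t ht => ?_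
    obtain ⟨-, w, hw, h⟩ := isBranch t ht
    rwa [Function.comp_apply, ← h, letters_toSP]
  · refine SPWord.isPar_foldr_par.2 (List.forall_mem_map.2 fun t ht => ?_)
    obtain ⟨-, w, -, h⟩ := isBranch t ht
    exact h ▸ isPar_toSP w

theorem isBranchRun_of_run {p q : (semilinearAutomaton v F).State} {x : SPWord α}
    (h : (semilinearAutomaton v F).Run p x q) : IsBranchRun v F p x q := by
  induction h with
  | empty p => exact .inl ⟨rfl, rfl⟩
  | letter h => exact h.elim
  | seq _ _ ih ih' =>
    obtain ⟨rfl, rfl⟩ | ⟨j, rfl, rfl, hx⟩ := ih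
    · rwa [SPWord.empty_seq]
    · obtain ⟨rfl, rfl⟩ | ⟨_, h, _⟩ := ih'
      · rw [SPWord.seq_empty]
        exact .inr ⟨j, rfl, rfl, hx⟩
      · cases h
  | fork l hfork hjoin _ ih =>
    obtain ⟨j, hj⟩ := hfork
    obtain ⟨j', hj'⟩ := hjoin
    obtain ⟨rfl, hstart⟩ := Prod.mk.inj hj
    obtain ⟨hend, rfl⟩ := Prod.mk.inj hj'
    exact isBranchRun_fork hstart hend ih
  | par h =>
    obtain ⟨j, _, hw, ⟨⟩⟩ := Set.mem_iUnion.1 h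
    exact .inr ⟨j, rfl, rfl, _, branchWords_subset_branchLanguage v F j hw, rfl⟩

theorem run_semilinearAutomaton {j : Fin n × Bool} {w : ParWord α}
    (hw : w ∈ branchLanguage v F j) :
    (semilinearAutomaton v F).Run (j, false) w.toSP (j, true) := by
  refine branchLanguage_subset
    (R := fun j => {w | (semilinearAutomaton v F).Run (j, false) w.toSP (j, true)}) ?_ ?_ j hw
  · exact fun j w hw => .par (Set.mem_iUnion.2 ⟨j, w, hw, rfl⟩)
  · rintro j _ ⟨u, hu, w, hw, rfl⟩
    have h := BranchingAutomaton.Run.fork (A := semilinearAutomaton v F)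
      [(((j.1, false), false), u.toSP, ((j.1, false), true)), ((j, false), w.toSP, (j, true))]
      ⟨j, rfl⟩ ⟨j, rfl⟩ (by simpa using ⟨hu, hw⟩)
    simpa [← toSP_add] using h

theorem language_semilinearAutomaton :
    (semilinearAutomaton v F).language =
      toSP '' ⋃ i, v i +ᵥ (AddSubmonoid.closure (F i : Set (ParWord α)) : Set (ParWord α)) := by
  ext x
  simp only [Set.image_iUnion, Set.mem_iUnion]
  constructor
  · rintro ⟨_, ⟨i, rfl⟩, _, ⟨i', rfl⟩, h⟩
    obtain ⟨h, -⟩ | ⟨j, ⟨⟩, -, w, hw, rfl⟩ := isBranchRun_of_run h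
    · cases h
    · exact ⟨i, w, hw, rfl⟩
  · rintro ⟨i, w, hw, rfl⟩
    exact ⟨_, ⟨i, rfl⟩, _, ⟨i, rfl⟩, run_semilinearAutomaton (j := (i, true)) hw⟩

theorem exists_branchingAutomaton_language_eq {L : Set (ParWord α)} (hL : IsSemilinearSet L) :
    ∃ A : BranchingAutomaton α, A.language = toSP '' L := by
  obtain ⟨n, v, F, rfl⟩ := exists_eq_iUnion_vadd_closure hL
  exact ⟨semilinearAutomaton v F, language_semilinearAutomaton⟩

end SemilinearAutomaton

theorem finite_preimage_multiset_map {γ δ : Type*} [Finite γ] (f : γ → δ) {T : Set (Multiset δ)}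
    (hT : T.Finite) : (Multiset.map f ⁻¹' T).Finite := by
  refine hT.preimage' fun N _ => ?_
  have := Fintype.ofFinite γ
  classical
  refine (Set.finite_range fun s : Sym γ (Multiset.card N) => (s : Multiset γ)).subset ?_
  rintro M rfl
  exact ⟨⟨M, (Multiset.card_map f M).symm⟩, rfl⟩

namespace BranchingAutomaton

open ParWord

variable {α : Type*} (A : BranchingAutomaton α)

/-- The productions `(p, q) → β` of a system of equations whose unknown `(p, q)` stands for the
parallel words that label a run from `p` to `q`. A sequential composition that is a parallel word
has an empty factor, hence the productions `empty` and `unit` for the runs labelled `ε`. -/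
inductive RunProd : A.State × A.State → ParWord ((A.State × A.State) ⊕ α) → Prop
  | empty {p q} : A.Run p SPWord.empty q → RunProd (p, q) 0
  | letter {p q a} : (p, a, q) ∈ A.seqTrans → RunProd (p, q) {Sum.inr a}
  | unit {p p' q' q} : A.Run p SPWord.empty p' → A.Run q' SPWord.empty q →
      RunProd (p, q) {Sum.inl (p', q')}
  | fork {p q} (M : Multiset (A.State × A.State)) : (p, M.map Prod.fst) ∈ A.forkTrans →
      (M.map Prod.snd, q) ∈ A.joinTrans → RunProd (p, q) (M.map Sum.inl)
  | par {p q M N w} : ((p, M), w, (N, q)) ∈ A.parTrans → RunProd (p, q) (w.map Sum.inr)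

/-- The parallel words that label a run from `t.1` to `t.2`. -/
def runLanguage (t : A.State × A.State) : Set (ParWord α) := {w | A.Run t.1 w.toSP t.2}

theorem finite_setOf_runProd (t : A.State × A.State) : {β | A.RunProd t β}.Finite := by
  have := A.finite_state
  have finite_letter : ((fun t => {Sum.inr t.2.1}) '' A.seqTrans :
      Set (ParWord ((A.State × A.State) ⊕ α))).Finite := A.finite_seq.image _
  have finite_unit : (Set.range fun t : A.State × A.State => ({Sum.inl t} :
      ParWord ((A.State × A.State) ⊕ α))).Finite := Set.finite_range _
  have finite_fork : (Multiset.map Sum.inl ''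
      (Multiset.map Prod.fst ⁻¹' (Prod.snd '' A.forkTrans)) :
        Set (ParWord ((A.State × A.State) ⊕ α))).Finite :=
    (finite_preimage_multiset_map _ (A.finite_fork.image _)).image _
  have finite_par : ((fun t => t.2.1.map Sum.inr) '' A.parTrans :
      Set (ParWord ((A.State × A.State) ⊕ α))).Finite := A.finite_par.image _
  refine ((((Set.finite_singleton 0).union finite_letter).union finite_unit).union
    (finite_fork.union finite_par)).subset fun β hβ => ?_
  cases hβ with
  | empty => exact .inl (.inl (.inl rfl))
  | letter h => exact .inl (.inl (.inr ⟨_, h, rfl⟩))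
  | unit => exact .inl (.inr ⟨_, rfl⟩)
  | fork M h => exact .inr (.inl ⟨M, ⟨_, h, rfl⟩, rfl⟩)
  | par h => exact .inr (.inr ⟨_, h, rfl⟩)

variable {A}

theorem exists_branches_of_mem_sum {M : Multiset (A.State × A.State)} {w : ParWord α}
    (hw : w ∈ (M.map A.runLanguage).sum) :
    ∃ l : List (A.State × SPWord α × A.State),
      (↑(l.map fun t => t.1) : Multiset A.State) = M.map Prod.fst ∧
      (↑(l.map fun t => t.2.2) : Multiset A.State) = M.map Prod.snd ∧
      (∀ t ∈ l, A.Run t.1 t.2.1 t.2.2) ∧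
      (l.map fun t => t.2.1).foldr SPWord.par SPWord.empty = w.toSP := by
  induction M using Multiset.induction_on generalizing w with
  | empty => exact ⟨[], rfl, rfl, List.forall_mem_nil _, by rw [Set.mem_zero.1 hw]; rfl⟩
  | cons t M ih =>
    rw [Multiset.map_cons, Multiset.sum_cons] at hw
    obtain ⟨u, hu, v, hv, rfl⟩ := hw
    obtain ⟨l, starts_eq, ends_eq, hl, foldr_eq⟩ := ih hv
    refine ⟨(t.1, toSP u, t.2) :: l, ?_, ?_, List.forall_mem_cons.2 ⟨hu, hl⟩, ?_⟩
    · rw [Multiset.map_cons, ← starts_eq]; rfl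
    · rw [Multiset.map_cons, ← ends_eq]; rfl
    · rw [List.map_cons, List.foldr_cons, foldr_eq]
      exact (toSP_add u v).symm

theorem runLanguage_mem_preSolutions :
    A.runLanguage ∈ preSolutions fun t => {β | A.RunProd t β} := by
  refine mem_preSolutions.2 fun t β hβ (w : ParWord α) hw => ?_
  change A.Run t.1 w.toSP t.2
  cases hβ with
  | empty h =>
    rw [Set.mem_zero.1 hw]
    exact h
  | @letter _ _ a h =>
    obtain rfl : w = {a} := by simpa [assign] using hw
    rw [toSP_singleton]
    exact .letter h
  | @unit _ p' q' _ h h' =>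
    have hrun : w ∈ A.runLanguage (p', q') := by simpa [assign] using hw
    rw [← SPWord.seq_empty w.toSP, ← SPWord.empty_seq (SPWord.seq _ _)]
    exact .seq h (.seq hrun h')
  | fork M hfork hjoin =>
    rw [Multiset.map_map] at hw
    obtain ⟨l, starts_eq, ends_eq, hl, foldr_eq⟩ := exists_branches_of_mem_sum hw
    rw [← foldr_eq]
    exact .fork l (starts_eq ▸ hfork) (ends_eq ▸ hjoin) hl
  | par h =>
    rw [sum_map_assign_inr] at hw
    rw [Set.mem_singleton_iff.1 hw]
    exact .par h

theorem Run.letters_mem {N : A.State × A.State → Set (ParWord α)}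
    (hN : N ∈ preSolutions fun t => {β | A.RunProd t β}) {p q : A.State} {x : SPWord α}
    (h : A.Run p x q) (hx : x.IsPar) : x.letters ∈ N (p, q) := by
  rw [mem_preSolutions] at hN
  have mem_of_unit {p p' q' q : A.State} (h : A.Run p SPWord.empty p')
      (h' : A.Run q' SPWord.empty q) {w : ParWord α} (hw : w ∈ N (p', q')) : w ∈ N (p, q) :=
    hN _ _ (.unit h h') (by simpa [assign] using hw)
  induction h with
  | empty p => exact hN _ _ (.empty (.empty p)) Set.zero_mem_zero
  | letter h => exact hN _ _ (.letter h) (by simp [assign])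
  | @seq p q r x y h h' ih ih' =>
    obtain ⟨hx | hy, hx', hy'⟩ := SPWord.isPar_seq.1 hx
    · obtain rfl := SPWord.eq_empty_of_letters_eq_zero hx
      rw [SPWord.empty_seq]
      exact mem_of_unit h (.empty r) (ih' hy')
    · obtain rfl := SPWord.eq_empty_of_letters_eq_zero hy
      rw [SPWord.seq_empty]
      exact mem_of_unit (.empty p) h' (ih hx')
  | @fork p q l hfork hjoin _ ih =>
    have hprod : A.RunProd (p, q) (Multiset.map Sum.inl ↑(l.map fun t => (t.1, t.2.2))) :=
      .fork _ (by simpa [Function.comp_def] using hfork) (by simpa [Function.comp_def] using hjoin)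
    refine hN _ _ hprod ?_
    rw [SPWord.letters_foldr_par]
    simp only [Multiset.map_coe, Multiset.sum_coe, List.map_map]
    rw [SPWord.isPar_foldr_par, List.forall_mem_map] at hx
    exact Set.list_sum_mem_list_sum l _ _ fun t ht => ih t ht (hx t ht)
  | par h =>
    rw [letters_toSP]
    exact hN _ _ (.par h) (by rw [sum_map_assign_inr]; rfl)

theorem isLeast_runLanguage (A : BranchingAutomaton α) :
    IsLeast (preSolutions fun t => {β | A.RunProd t β}) A.runLanguage := by
  refine ⟨runLanguage_mem_preSolutions, fun N hN t w hw => ?_⟩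
  simpa using Run.letters_mem hN hw (isPar_toSP w)

theorem isSemilinearSet_preimage_language (A : BranchingAutomaton α) :
    IsSemilinearSet {w : ParWord α | w.toSP ∈ A.language} := by
  have := A.finite_state
  have language_eq : {w : ParWord α | w.toSP ∈ A.language} =
      ⋃ p ∈ A.start, ⋃ q ∈ A.final, A.runLanguage (p, q) := by
    ext w
    simp [language, runLanguage]
  rw [language_eq]
  exact .biUnion (Set.toFinite _) fun p _ => .biUnion (Set.toFinite _) fun q _ =>
    isSemilinearSet_of_isLeast (fun t => .of_finite (A.finite_setOf_runProd t))
      A.isLeast_runLanguage (p, q)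

end BranchingAutomaton

theorem theorem2_general {α : Type*} (L : Set (ParWord α)) :
    List.TFAE [
      IsParallelRegular L,
      ∃ G : ParallelGrammar α, G.IsLinear ∧ G.language = L,
      ∃ A : BranchingAutomaton α, A.language = ParWord.toSP '' L,
      ∃ A : BranchingAutomaton α, {w : ParWord α | w.toSP ∈ A.language} = L] := by
  tfae_have 1 → 2 := fun h =>
    exists_isLinear_language_eq (isParallelRegular_iff_isSemilinearSet.1 h)
  tfae_have 2 → 3 := by
    rintro ⟨G, -, rfl⟩
    exact exists_branchingAutomaton_language_eq G.isSemilinearSet_language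
  tfae_have 3 → 4 := by
    rintro ⟨A, hA⟩
    exact ⟨A, by rw [hA]; exact Set.preimage_image_eq L ParWord.toSP_injective⟩
  tfae_have 4 → 1 := by
    rintro ⟨A, rfl⟩
    exact isParallelRegular_iff_isSemilinearSet.2 A.isSemilinearSet_preimage_language
  tfae_finish

theorem theorem2 {α : Type*} [Finite α] (L : Set (ParWord α)) :
    List.TFAE [
      IsParallelRegular L,
      ∃ G : ParallelGrammar α, G.IsLinear ∧ G.language = L,
      ∃ A : BranchingAutomaton α, A.language = ParWord.toSP '' L,
      ∃ A : BranchingAutomaton α, {w : ParWord α | w.toSP ∈ A.language} = L] :=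
  theorem2_general L
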